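/- Let $X$ be a compact metrizable space, let $J$ be a free interval of $X$ (that is, an open subset of $X$ homeomorphic to an open interval of the real line), and let $f\colon X\to X$ be a continuous map. Let $M\subseteq X$ be a minimal set for $f$, that is, a nonempty closed set with $f(M)\subseteq M$ such that for every $x\in M$ the orbit $\{f^n(x): n\ge 0\}$ is dense in $M$. Assume that $M\cap J\neq\emptyset$. Then exactly one of the following three statements holds. 1. $M$ is finite. 2. $M$ is nowhere dense in $X$ and $M$ is a cantoroid, that is, a compact metrizable space without isolated points in which the union of the one-point connected components is dense. 3. $M$ is a disjoint union of finitely many circles, that is, for some integer $n\ge 1$, $M$ is homeomorphic to the topological direct sum of $n$ copies of $\mathbb S^1$. -/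

import Mathlib

/-- `J` is a free interval of `X`: an open subset of `X` homeomorphic to an open interval of the
real line (every nonempty open interval, bounded or not, is homeomorphic to a bounded one). -/
def IsFreeInterval {X : Type*} [TopologicalSpace X] (J : Set X) : Prop :=
  IsOpen J ∧ ∃ a b : ℝ, a < b ∧ Nonempty (J ≃ₜ Set.Ioo a b)

/-- The orbit `{fⁿ(x) : n ≥ 0}` of a point. -/
def forwardOrbit {X : Type*} (f : X → X) (x : X) : Set X :=
  Set.range fun n : ℕ => f^[n] x

/-- The system `(X, f)` is minimal: every orbit is dense. -/
def IsMinimalMap {X : Type*} [TopologicalSpace X] (f : X → X) : Prop :=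
  ∀ x : X, Dense (forwardOrbit f x)

/-- `A` is a minimal set for `f`: it is nonempty, closed, `f(A) ⊆ A`, and the restricted system
`(A, f|_A)`, with the subspace topology on `A`, is minimal. -/
def IsMinimalSet {X : Type*} [TopologicalSpace X] (f : X → X) (A : Set X) : Prop :=
  A.Nonempty ∧ IsClosed A ∧ ∃ h : Set.MapsTo f A A, IsMinimalMap (h.restrict f A A)

/-- A cantoroid: a compact metrizable space without isolated points in which the degenerate
(one-point) connected components are dense. -/
def IsCantoroid (Y : Type*) [TopologicalSpace Y] : Prop :=
  CompactSpace Y ∧ TopologicalSpace.MetrizableSpace Y ∧ (∀ y : Y, ¬ IsOpen ({y} : Set Y)) ∧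
    Dense {y : Y | connectedComponent y = {y}}

/-- `Y` is (homeomorphic to) a topological disjoint union of `n ≥ 1` circles. -/
def IsFiniteUnionOfCircles (Y : Type*) [TopologicalSpace Y] : Prop :=
  ∃ n : ℕ, 1 ≤ n ∧ Nonempty (Y ≃ₜ (Σ _ : Fin n, Circle))

/-!
A minimal map `F` of a compact Hausdorff space is irreducible: every nonempty open set contains the
full preimage of a nonempty open set (`IsMinimalMap.isIrreducibleMap`). Let `M` be an infinite
minimal set and let `ψ : ℝ → X` parametrize the free interval; the two infinite alternatives
correspond to whether or not `M` contains an interval of `ψ`.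

If it does not, then the points of `M` on the free interval have trivial components
(`IsPreconnected.eq_singleton_of_chart`). Pulling back along an iterate and using that, by Baire's
theorem, a dense set of points is alone in its fibre (`IsIrreducibleMap.exists_fiber_singleton`),
the points with trivial components are dense, so `M` is a cantoroid. Moreover `M` is nowhere dense:
otherwise a small interval around a point of `M` would be mapped into `M` and then onto a trivial
component, whereas iterates of `F` are constant on no nonempty open subset of `M`.

If it does, then `M` itself has a chart. By the intermediate value theorem an irreducible map
between two charts is injective (`IsIrreducibleMap.injective_of_lift`), hence an open embedding, and
its fibres there are singletons. Since every point of `M` is both an iterated image of the chart and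
eventually mapped into the chart, every point has a chart (`IsMinimalMap.exists_chart`), and `F` is
injective. So `M` is a compact one-manifold. It contains a simple closed curve
(`exists_continuous_injective_addCircle`): a locally injective curve that keeps running along
finitely many charts must traverse the end of one of them twice, and a shortest loop of it is
simple. By invariance of domain this curve is open, so its images under `F` are clopen and
connected; they are equal or disjoint, are permuted cyclically, and exhaust `M` by minimality.
-/

open Set Filter Topology

/-! ### Irreducible maps and minimal maps -/

/-- A map is irreducible if it is surjective and every nonempty open set of the domain contains
the full preimage of some nonempty open set. For a closed surjection this says that no proper
closed subset is mapped onto the codomain. -/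
def IsIrreducibleMap {Y Z : Type*} [TopologicalSpace Y] [TopologicalSpace Z] (g : Y → Z) : Prop :=
  Function.Surjective g ∧ ∀ V : Set Y, IsOpen V → V.Nonempty →
    ∃ W : Set Z, IsOpen W ∧ W.Nonempty ∧ g ⁻¹' W ⊆ V

lemma IsIrreducibleMap.iterate {Z : Type*} [TopologicalSpace Z] {F : Z → Z}
    (h : IsIrreducibleMap F) (n : ℕ) : IsIrreducibleMap F^[n] := by
  induction n with
  | zero => exact ⟨Function.surjective_id, fun V hV hne => ⟨V, hV, hne, subset_rfl⟩⟩
  | succ n ih =>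
    refine ⟨h.1.iterate _, fun V hV hne => ?_⟩
    obtain ⟨W', hW', hne', hsub'⟩ := h.2 V hV hne
    obtain ⟨W, hW, hneW, hsub⟩ := ih.2 W' hW' hne'
    exact ⟨W, hW, hneW, fun x hx => hsub' (hsub (by simpa using hx))⟩

section Minimal

variable {Z : Type*} [TopologicalSpace Z] {F : Z → Z}

lemma IsMinimalMap.exists_iterate_mem (hm : IsMinimalMap F) {U : Set Z} (hU : IsOpen U)
    (hne : U.Nonempty) (z : Z) : ∃ n, F^[n] z ∈ U := by
  obtain ⟨_, hy, n, rfl⟩ := (hm z).inter_open_nonempty U hU hne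
  exact ⟨n, hy⟩

lemma IsMinimalMap.eq_univ (hm : IsMinimalMap F) {A : Set Z} (hA : IsClosed A)
    (hne : A.Nonempty) (hmaps : MapsTo F A A) : A = univ := by
  obtain ⟨a, ha⟩ := hne
  refine eq_univ_of_univ_subset ?_
  rw [← (hm a).closure_eq]
  refine closure_minimal ?_ hA
  rintro _ ⟨n, rfl⟩
  exact hmaps.iterate n ha

/-- In a compact minimal system the hitting times of a nonempty open set are uniformly bounded. -/
lemma IsMinimalMap.exists_bound [CompactSpace Z] (hF : Continuous F) (hm : IsMinimalMap F)
    {U : Set Z} (hU : IsOpen U) (hne : U.Nonempty) : ∃ N, ∀ z, ∃ n ≤ N, F^[n] z ∈ U := by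
  obtain ⟨t, ht⟩ := isCompact_univ.elim_finite_subcover (fun n : ℕ => F^[n] ⁻¹' U)
    (fun n => hU.preimage (hF.iterate n))
    (fun z _ => mem_iUnion.2 (hm.exists_iterate_mem hU hne z))
  refine ⟨t.sup id, fun z => ?_⟩
  obtain ⟨n, hn, hz⟩ := mem_iUnion₂.1 (ht (mem_univ z))
  exact ⟨n, Finset.le_sup (f := id) hn, hz⟩

lemma IsMinimalMap.surjective [CompactSpace Z] [T2Space Z] (hF : Continuous F)
    (hm : IsMinimalMap F) : Function.Surjective F := by
  rcases isEmpty_or_nonempty Z with h | h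
  · exact fun z => isEmptyElim z
  · exact range_eq_univ.1 (hm.eq_univ (isCompact_range hF).isClosed (range_nonempty F)
      fun x _ => mem_range_self x)

/-- Every point is an iterated image of a point of a given nonempty open set. -/
lemma IsMinimalMap.exists_iterate_eq [CompactSpace Z] [T2Space Z] (hF : Continuous F)
    (hm : IsMinimalMap F) {U : Set Z} (hU : IsOpen U) (hne : U.Nonempty) (z : Z) :
    ∃ y ∈ U, ∃ k, F^[k] y = z := by
  obtain ⟨N, hN⟩ := hm.exists_bound hF hU hne
  obtain ⟨b, hb⟩ := (hm.surjective hF).iterate N z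
  obtain ⟨n, hn, hbn⟩ := hN b
  refine ⟨_, hbn, N - n, ?_⟩
  rw [← Function.iterate_add_apply, Nat.sub_add_cancel hn, hb]

/-- If a closed set `A` is mapped onto the whole space, then there are arbitrarily long orbit
segments inside `A`, so the bounded hitting times of `Aᶜ` force `A` to be everything. -/
lemma IsMinimalMap.isIrreducibleMap [CompactSpace Z] [T2Space Z] (hF : Continuous F)
    (hm : IsMinimalMap F) : IsIrreducibleMap F := by
  refine ⟨hm.surjective hF, fun V hV hne => ⟨(F '' Vᶜ)ᶜ, ?_, ?_, ?_⟩⟩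
  · exact (hV.isClosed_compl.isCompact.image hF).isClosed.isOpen_compl
  · rw [nonempty_compl]
    intro h
    obtain ⟨N, hN⟩ := hm.exists_bound hF hV hne
    have h' : ∀ z, ∃ y, y ∈ Vᶜ ∧ F y = z := fun z => by
      have : z ∈ F '' Vᶜ := h ▸ mem_univ z
      exact this
    choose g hgV hg using h'
    obtain ⟨x, -⟩ := hne
    obtain ⟨n, hn, hx⟩ := hN (g^[N + 1] x)
    have hinv : ∀ n z, F^[n] (g^[n] z) = z := fun n => Function.LeftInverse.iterate hg n
    have : N + 1 = n + (N - n + 1) := by omega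
    rw [this, Function.iterate_add_apply, hinv, Function.iterate_succ_apply'] at hx
    exact hgV _ hx
  · intro y hy
    by_contra hyV
    exact hy ⟨y, hyV, rfl⟩

lemma IsMinimalMap.finite_of_isOpen_singleton [CompactSpace Z] [T2Space Z] (hF : Continuous F)
    (hm : IsMinimalMap F) {c : Z} (hc : IsOpen ({c} : Set Z)) : Finite Z := by
  obtain ⟨N, hN⟩ := hm.exists_bound hF hc (singleton_nonempty c)
  obtain ⟨n, hn, hret⟩ := hN (F c)
  have hret : F^[n + 1] c = c := hret
  have hfin : ((fun k => F^[k] c) '' Iic n).Finite := (finite_Iic n).image _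
  have : (fun k => F^[k] c) '' Iic n = univ := by
    refine hm.eq_univ hfin.isClosed ⟨c, 0, by simp⟩ ?_
    rintro _ ⟨k, hk, rfl⟩
    rcases (mem_Iic.1 hk).lt_or_eq with h | rfl
    · exact ⟨k + 1, h, Function.iterate_succ_apply' F k c⟩
    · exact ⟨0, by simp, by simpa [Function.iterate_succ_apply'] using hret.symm⟩
  exact finite_univ_iff.1 (this ▸ hfin)

/-- In an infinite compact minimal system no iterate is constant on a nonempty open set. -/
lemma IsMinimalMap.not_const_on_open [CompactSpace Z] [T2Space Z] [Infinite Z]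
    (hF : Continuous F) (hm : IsMinimalMap F) {V : Set Z} (hV : IsOpen V) (hne : V.Nonempty)
    (n : ℕ) (c : Z) : ¬ ∀ v ∈ V, F^[n] v = c := by
  intro hconst
  have hirr := (hm.isIrreducibleMap hF).iterate n
  obtain ⟨W, hW, ⟨w, hw⟩, hsub⟩ := hirr.2 V hV hne
  have hWc : ∀ w ∈ W, w = c := by
    intro w hw
    obtain ⟨v, rfl⟩ := hirr.1 w
    exact hconst v (hsub hw)
  have : W = {c} := eq_singleton_iff_unique_mem.2 ⟨hWc w hw ▸ hw, hWc⟩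
  have := hm.finite_of_isOpen_singleton hF (this ▸ hW)
  exact not_finite Z

end Minimal

/-- An irreducible map of a compact metrizable space has, over every nonempty open set, a fibre
consisting of a single point: by Baire's theorem, the fibres of small diameter are generic. -/
lemma IsIrreducibleMap.exists_fiber_singleton {Z : Type*} [TopologicalSpace Z] [CompactSpace Z]
    [TopologicalSpace.MetrizableSpace Z] {g : Z → Z} (hg : Continuous g)
    (hirr : IsIrreducibleMap g) {V : Set Z} (hV : IsOpen V) (hne : V.Nonempty) :
    ∃ y ∈ V, ∀ z, g z = g y → z = y := by
  let _ := TopologicalSpace.metrizableSpaceMetric Z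
  -- `G k` consists of the points having a neighbourhood with preimage of diameter `≤ 2 / (k + 1)`
  let G : ℕ → Set Z := fun k => ⋃₀ {W | IsOpen W ∧
    ∃ x : Z, g ⁻¹' W ⊆ Metric.ball x (1 / ((k : ℝ) + 1))}
  have hGo : ∀ k, IsOpen (G k) := fun k => isOpen_sUnion fun W hW => hW.1
  have hGd : ∀ k, Dense (G k) := by
    intro k
    rw [dense_iff_inter_open]
    rintro U hU ⟨u, hu⟩
    obtain ⟨x, rfl⟩ := hirr.1 u
    have hpos : (0 : ℝ) < 1 / ((k : ℝ) + 1) := by positivity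
    obtain ⟨W, hW, ⟨w, hw⟩, hsub⟩ := hirr.2 (g ⁻¹' U ∩ Metric.ball x (1 / ((k : ℝ) + 1)))
      ((hU.preimage hg).inter Metric.isOpen_ball) ⟨x, hu, Metric.mem_ball_self hpos⟩
    obtain ⟨v, rfl⟩ := hirr.1 w
    exact ⟨g v, (hsub hw).1, W, ⟨hW, x, fun y hy => (hsub hy).2⟩, hw⟩
  obtain ⟨W, hW, hneW, hsub⟩ := hirr.2 V hV hne
  obtain ⟨w, hwW, hwG⟩ := (dense_iInter_of_isOpen hGo hGd).inter_open_nonempty W hW hneW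
  obtain ⟨y, rfl⟩ := hirr.1 w
  refine ⟨y, hsub hwW, fun z hz => ?_⟩
  refine eq_of_forall_dist_le fun ε hε => ?_
  obtain ⟨k, hk⟩ := exists_nat_one_div_lt (half_pos hε)
  obtain ⟨W', ⟨-, x, hx⟩, hyW'⟩ := mem_iInter.1 hwG k
  have h1 : dist y x < _ := hx hyW'
  have h2 : dist z x < _ := hx (show g z ∈ W' from hz ▸ hyW')
  linarith [dist_triangle_right z y x]

/-! ### Charts: open embeddings of the real line -/

lemma exists_isOpenEmbedding_range_eq_Ioo {a b : ℝ} (hab : a < b) :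
    ∃ u : ℝ → ℝ, IsOpenEmbedding u ∧ range u = Ioo a b := by
  let e := (orderIsoIooNegOneOne ℝ).toHomeomorph
  have hr : (b - a) / 2 ≠ 0 := by linarith
  let A : ℝ ≃ₜ ℝ := (Homeomorph.mulLeft₀ ((b - a) / 2) hr).trans (Homeomorph.addLeft ((a + b) / 2))
  have hA : ∀ t, A t = (a + b) / 2 + (b - a) / 2 * t := fun t => rfl
  refine ⟨A ∘ Subtype.val ∘ e, A.isOpenEmbedding.comp
    (isOpen_Ioo.isOpenEmbedding_subtypeVal.comp e.isOpenEmbedding), ?_⟩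
  rw [range_comp, range_comp, e.range_coe, image_univ, Subtype.range_coe]
  ext y
  constructor
  · rintro ⟨t, ht, rfl⟩
    rw [hA]
    constructor <;> nlinarith [ht.1, ht.2]
  · intro hy
    refine ⟨(y - (a + b) / 2) / ((b - a) / 2), ⟨?_, ?_⟩, ?_⟩
    · rw [lt_div_iff₀ (by linarith)]; linarith [hy.1]
    · rw [div_lt_iff₀ (by linarith)]; linarith [hy.2]
    · rw [hA, mul_div_cancel₀ _ hr]; ring

lemma IsFreeInterval.exists_chart {X : Type*} [TopologicalSpace X] {J : Set X}
    (hJ : IsFreeInterval J) : ∃ ψ : ℝ → X, IsOpenEmbedding ψ ∧ range ψ = J := by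
  obtain ⟨hJo, a, b, hab, ⟨e⟩⟩ := hJ
  obtain ⟨u, hu, hur⟩ := exists_isOpenEmbedding_range_eq_Ioo hab
  have hmem : ∀ t, u t ∈ Ioo a b := fun t => hur ▸ mem_range_self t
  let v : ℝ → Ioo a b := fun t => ⟨u t, hmem t⟩
  have hv : IsOpenEmbedding v :=
    .of_comp v isOpen_Ioo.isOpenEmbedding_subtypeVal hu
  have hvs : Function.Surjective v := by
    rintro ⟨y, hy⟩
    obtain ⟨t, rfl⟩ : y ∈ range u := hur ▸ hy
    exact ⟨t, rfl⟩
  refine ⟨Subtype.val ∘ e.symm ∘ v,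
    hJo.isOpenEmbedding_subtypeVal.comp (e.symm.isOpenEmbedding.comp hv), ?_⟩
  rw [(e.symm.surjective.comp hvs).range_comp, Subtype.range_coe]

/-- Charts can be recentred and shrunk into any given neighbourhood. -/
lemma Topology.IsOpenEmbedding.exists_shrink {Z : Type*} [TopologicalSpace Z] {ψ : ℝ → Z}
    (hψ : IsOpenEmbedding ψ) {t : ℝ} {U : Set Z} (hU : U ∈ 𝓝 (ψ t)) :
    ∃ ψ' : ℝ → Z, IsOpenEmbedding ψ' ∧ ψ' 0 = ψ t ∧ range ψ' ⊆ U := by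
  obtain ⟨l, u, ⟨hl, hu⟩, hsub⟩ :=
    mem_nhds_iff_exists_Ioo_subset.1 (hψ.continuous.continuousAt.preimage_mem_nhds hU)
  obtain ⟨v, hv, hvr⟩ := exists_isOpenEmbedding_range_eq_Ioo (hl.trans hu)
  obtain ⟨s, hs⟩ : t ∈ range v := hvr ▸ ⟨hl, hu⟩
  refine ⟨ψ ∘ v ∘ Homeomorph.addLeft s,
    hψ.comp (hv.comp (Homeomorph.addLeft s).isOpenEmbedding), by simp [hs], ?_⟩
  rintro _ ⟨x, rfl⟩
  exact hsub (hvr ▸ mem_range_self (s + x))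

/-- A continuous map into the range of an embedding factors through the embedding. -/
lemma Topology.IsEmbedding.exists_continuous_lift {T Y Z : Type*} [TopologicalSpace T]
    [TopologicalSpace Y] [TopologicalSpace Z] {φ : Y → Z} (hφ : IsEmbedding φ) {g : T → Z}
    (hg : Continuous g) (hr : range g ⊆ range φ) :
    ∃ h : T → Y, Continuous h ∧ φ ∘ h = g := by
  choose h hh using fun t => hr (mem_range_self t)
  have hc : φ ∘ h = g := funext hh
  exact ⟨h, hφ.continuous_iff.2 (hc ▸ hg), hc⟩

/-- Invariance of domain in dimension one. -/
lemma Continuous.isOpenEmbedding_of_injective_real {h : ℝ → ℝ} (hc : Continuous h)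
    (hi : Function.Injective h) : IsOpenEmbedding h := by
  have key : ∀ g : ℝ → ℝ, Continuous g → StrictMono g → IsOpenEmbedding g := by
    intro g hg hm
    refine ⟨hm.isEmbedding_of_ordConnected (isPreconnected_range hg).ordConnected, ?_⟩
    refine isOpen_iff_mem_nhds.2 ?_
    rintro _ ⟨t, rfl⟩
    have hsub : Icc (g (t - 1)) (g (t + 1)) ⊆ g '' Icc (t - 1) (t + 1) :=
      intermediate_value_Icc (by linarith) hg.continuousOn
    refine mem_of_superset (Icc_mem_nhds (hm (sub_one_lt t)) (hm (lt_add_one t))) ?_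
    exact hsub.trans (image_subset_range _ _)
  rcases hc.strictMono_of_inj hi with hm | hm
  · exact key h hc hm
  · have := key (fun t => -h t) hc.neg hm.neg
    simpa [Function.comp_def] using (Homeomorph.neg ℝ).isOpenEmbedding.comp this

/-! ### Irreducible maps between charts -/

section Irreducible

variable {Y Z : Type*} [TopologicalSpace Y] [TopologicalSpace Z] {g : Y → Z}

/-- An irreducible map that maps a chart into a chart is injective there. If it identified two
points `a < b` of the line, then, by the intermediate value theorem, an open set of points between
`a` and some `c < b` would take only values that are also taken between `c` and `b`. -/
lemma IsIrreducibleMap.injective_of_lift (hirr : IsIrreducibleMap g)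
    {ψ : ℝ → Y} (hψ : IsOpenEmbedding ψ) {φ : ℝ → Z} (hφ : IsOpenEmbedding φ)
    {h : ℝ → ℝ} (hc : Continuous h) (hh : φ ∘ h = g ∘ ψ) : Function.Injective h := by
  -- irreducibility passes to `h`: some nonempty open set of values taken on `O` is taken only there
  have key : ∀ O : Set ℝ, IsOpen O → O.Nonempty →
      ∃ O' : Set ℝ, IsOpen O' ∧ O'.Nonempty ∧ O' ⊆ h '' O ∧ h ⁻¹' O' ⊆ O := by
    intro O hO hne
    obtain ⟨W, hW, ⟨w, hw⟩, hsub⟩ := hirr.2 (ψ '' O) (hψ.isOpenMap O hO) (hne.image ψ)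
    have hW' : ∀ w ∈ W, ∃ t ∈ O, φ (h t) = w := by
      intro w hw
      obtain ⟨y, rfl⟩ := hirr.1 w
      obtain ⟨t, ht, rfl⟩ := hsub hw
      exact ⟨t, ht, congrFun hh t⟩
    refine ⟨φ ⁻¹' W, hW.preimage hφ.continuous, ?_, ?_, ?_⟩
    · obtain ⟨t, -, rfl⟩ := hW' w hw
      exact ⟨h t, hw⟩
    · intro s hs
      obtain ⟨t, ht, hts⟩ := hW' _ hs
      exact ⟨t, ht, hφ.injective hts⟩
    · intro t ht
      have : g (ψ t) ∈ W := by
        have h1 : φ (h t) ∈ W := ht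
        rwa [show φ (h t) = g (ψ t) from congrFun hh t] at h1
      obtain ⟨t', ht', he⟩ := hsub this
      exact hψ.injective he ▸ ht'
  suffices H : ∀ a b, a < b → h a ≠ h b by
    intro a b heq
    by_contra hne
    rcases lt_or_gt_of_ne hne with hlt | hlt
    · exact H a b hlt heq
    · exact H b a hlt heq.symm
  intro a b hab heq
  by_cases hconst : ∀ c ∈ Ioo a b, h c = h a
  · obtain ⟨O', hO', hne, hsub, -⟩ := key (Ioo a b) isOpen_Ioo (nonempty_Ioo.2 hab)
    have hO'a : ∀ s ∈ O', s = h a := by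
      intro s hs
      obtain ⟨c, hc, rfl⟩ := hsub hs
      exact hconst c hc
    obtain ⟨s, hs⟩ := hne
    have : O' = {h a} := eq_singleton_iff_unique_mem.2 ⟨hO'a s hs ▸ hs, hO'a⟩
    exact not_isOpen_singleton (h a) (this ▸ hO')
  · push Not at hconst
    obtain ⟨c, ⟨hac, hcb⟩, hne⟩ := hconst
    -- the open interval strictly between `h a` and `h c` is covered on both sides of `c`
    obtain ⟨I, hI, hIne, hIl, hIr⟩ : ∃ I : Set ℝ, IsOpen I ∧ I.Nonempty ∧
        I ⊆ h '' Ioo a c ∧ I ⊆ h '' Ioo c b := by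
      rcases hne.lt_or_gt with hlt | hlt
      · exact ⟨Ioo (h c) (h a), isOpen_Ioo, nonempty_Ioo.2 hlt,
          intermediate_value_Ioo' hac.le hc.continuousOn,
          heq ▸ intermediate_value_Ioo hcb.le hc.continuousOn⟩
      · exact ⟨Ioo (h a) (h c), isOpen_Ioo, nonempty_Ioo.2 hlt,
          intermediate_value_Ioo hac.le hc.continuousOn,
          heq ▸ intermediate_value_Ioo' hcb.le hc.continuousOn⟩
    obtain ⟨i, hi⟩ := hIne
    obtain ⟨x, hx, rfl⟩ := hIl hi
    obtain ⟨O', -, ⟨s, hs⟩, hsub, hpre⟩ := key (Ioo a c ∩ h ⁻¹' I)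
      (isOpen_Ioo.inter (hI.preimage hc)) ⟨x, hx, hi⟩
    obtain ⟨t, ht, rfl⟩ := hsub hs
    obtain ⟨t', ht', he⟩ := hIr ht.2
    have : t' ∈ Ioo a c ∩ h ⁻¹' I := hpre (show h t' ∈ O' from he ▸ hs)
    exact lt_asymm ht'.1 this.1.2

/-- Around a chart point that an irreducible map sends to a chart point, the map carries a small
chart to a chart. -/
lemma IsIrreducibleMap.exists_chart_comp (hirr : IsIrreducibleMap g) (hg : Continuous g)
    {ψ : ℝ → Y} (hψ : IsOpenEmbedding ψ) {φ : ℝ → Z} (hφ : IsOpenEmbedding φ)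
    {t : ℝ} (ht : g (ψ t) ∈ range φ) :
    ∃ ψ' : ℝ → Y, IsOpenEmbedding ψ' ∧ ψ' 0 = ψ t ∧ IsOpenEmbedding (g ∘ ψ') := by
  obtain ⟨ψ', hψ', h0, hr⟩ := hψ.exists_shrink
    (hg.continuousAt.preimage_mem_nhds (hφ.isOpen_range.mem_nhds ht))
  obtain ⟨h, hc, hh⟩ := hφ.isEmbedding.exists_continuous_lift (hg.comp hψ'.continuous)
    (by rintro _ ⟨s, rfl⟩; exact hr (mem_range_self s))
  refine ⟨ψ', hψ', h0, hh ▸ hφ.comp ?_⟩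
  exact hc.isOpenEmbedding_of_injective_real (hirr.injective_of_lift hψ' hφ hc hh)

/-- Where an irreducible map is locally an open embedding, its fibres are singletons. -/
lemma IsIrreducibleMap.eq_of_apply_eq [T2Space Y] (hirr : IsIrreducibleMap g) (hg : Continuous g)
    {ψ : ℝ → Y} (hψ : IsOpenEmbedding ψ) (hgψ : IsOpenEmbedding (g ∘ ψ)) {y : Y} {s : ℝ}
    (hy : g y = g (ψ s)) : y = ψ s := by
  by_contra hne
  obtain ⟨A, B, hA, hB, hyA, hsB, hdisj⟩ := t2_separation hne
  obtain ⟨W, -, ⟨w, hw⟩, hsub⟩ := hirr.2 (A ∩ g ⁻¹' (g ∘ ψ '' (ψ ⁻¹' B)))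
    (hA.inter ((hgψ.isOpenMap _ (hB.preimage hψ.continuous)).preimage hg))
    ⟨y, hyA, s, hsB, hy.symm⟩
  obtain ⟨v, rfl⟩ := hirr.1 w
  obtain ⟨-, r, hrB, hr⟩ := hsub hw
  have hrA : ψ r ∈ A := (hsub (show (g ∘ ψ) r ∈ W from hr.symm ▸ hw)).1
  exact hdisj.le_bot ⟨hrA, hrB⟩

end Irreducible

/-! ### Minimal systems with a chart are homeomorphisms of one-manifolds -/

section Manifold

variable {Z : Type*} [TopologicalSpace Z] [CompactSpace Z] [T2Space Z] {F : Z → Z}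

/-- Every point `z` has a chart: write `z = F^k y` with `y` in the given chart and let
`F^n z` be in the given chart. Then `F^(n + k)` is an open embedding with singleton fibres near
`y`, hence so is `F^k`. -/
lemma IsMinimalMap.exists_chart (hF : Continuous F) (hm : IsMinimalMap F) {ψ : ℝ → Z}
    (hψ : IsOpenEmbedding ψ) (z : Z) : ∃ φ : ℝ → Z, IsOpenEmbedding φ ∧ φ 0 = z := by
  obtain ⟨_, ⟨t, rfl⟩, k, rfl⟩ :=
    hm.exists_iterate_eq hF hψ.isOpen_range (range_nonempty ψ) z
  obtain ⟨n, hn⟩ := hm.exists_iterate_mem hψ.isOpen_range (range_nonempty ψ) (F^[k] (ψ t))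
  have hirr := hm.isIrreducibleMap hF
  have hcomp : ∀ x, F^[n] (F^[k] x) = F^[n + k] x := fun x =>
    (Function.iterate_add_apply F n k x).symm
  obtain ⟨ψ', hψ', h0, hG⟩ := (hirr.iterate (n + k)).exists_chart_comp (hF.iterate _) hψ hψ
    (t := t) (by rwa [← hcomp])
  refine ⟨F^[k] ∘ ψ', .of_continuous_injective_isOpenMap
    ((hF.iterate k).comp hψ'.continuous) ?_ ?_, by simp [h0]⟩
  · intro s s' hs
    refine hG.injective ?_
    simpa [← hcomp] using congrArg F^[n] hs
  · intro O hO
    have : F^[k] ∘ ψ' '' O = F^[n] ⁻¹' (F^[n + k] ∘ ψ' '' O) := by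
      ext a
      constructor
      · rintro ⟨s, hs, rfl⟩
        exact ⟨s, hs, (hcomp _).symm⟩
      · rintro ⟨s, hs, ha⟩
        obtain ⟨b, rfl⟩ := hirr.1.iterate k a
        refine ⟨s, hs, ?_⟩
        rw [hcomp] at ha
        rw [(hirr.iterate (n + k)).eq_of_apply_eq (hF.iterate _) hψ' hG (y := b) ha.symm]
        rfl
    rw [this]
    exact (hG.isOpenMap O hO).preimage (hF.iterate n)

lemma IsMinimalMap.injective_of_chart (hF : Continuous F) (hm : IsMinimalMap F) {ψ : ℝ → Z}
    (hψ : IsOpenEmbedding ψ) : Function.Injective F := by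
  intro a b hab
  obtain ⟨φ, hφ, rfl⟩ := hm.exists_chart hF hψ b
  obtain ⟨χ, hχ, h0⟩ := hm.exists_chart hF hψ (F (φ 0))
  obtain ⟨φ', hφ', h0', hG⟩ := (hm.isIrreducibleMap hF).exists_chart_comp hF hφ hχ
    (t := 0) ⟨0, h0⟩
  rw [← h0'] at hab ⊢
  exact (hm.isIrreducibleMap hF).eq_of_apply_eq hF hφ' hG hab

end Manifold

/-! ### Simple closed curves in compact one-manifolds -/

section Curve

variable {Z : Type*} [TopologicalSpace Z]

/-- A map of the line that is injective near every point. -/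
def LocallyInjective (γ : ℝ → Z) : Prop := ∀ t, ∃ U ∈ 𝓝 t, InjOn γ U

/-- A curve that moves upwards in the chart `φ` just before time `n` can be redirected, after time
`n`, along the upper end of the chart, and stays locally injective. -/
lemma LocallyInjective.exists_extension_of_strictMonoOn {γ : ℝ → Z} (hγ : Continuous γ)
    (hγi : LocallyInjective γ) {n ε : ℝ} (hε : 0 < ε) {φ : ℝ → Z} (hφ : IsOpenEmbedding φ)
    {h : ℝ → ℝ} (hmono : StrictMonoOn h (Icc (n - ε) n)) (hh : ∀ t ∈ Icc (n - ε) n, φ (h t) = γ t)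
    (hn : h n < 1) :
    ∃ γ' : ℝ → Z, Continuous γ' ∧ LocallyInjective γ' ∧ EqOn γ' γ (Iic n) ∧
      φ '' Icc 1 2 ⊆ γ' '' Icc n (n + 1) := by
  have hnmem : n ∈ Icc (n - ε) n := ⟨by linarith, le_rfl⟩
  let H : ℝ → ℝ := fun t => if t ≤ n then h t else h n + (t - n) * (2 - h n)
  let γ' : ℝ → Z := fun t => if t ≤ n then γ t else φ (h n + (t - n) * (2 - h n))
  have hγ'le : EqOn γ' γ (Iic n) := fun t ht => if_pos ht
  have hγ'H : ∀ t ∈ Ici (n - ε), γ' t = φ (H t) := by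
    intro t ht
    by_cases htn : t ≤ n
    · simp only [γ', H, if_pos htn]
      exact (hh t ⟨ht, htn⟩).symm
    · simp only [γ', H, if_neg htn]
  have hH : StrictMonoOn H (Ici (n - ε)) := by
    intro x hx y hy hxy
    by_cases hyn : y ≤ n
    · have hxn := hxy.le.trans hyn
      simp only [H, if_pos hxn, if_pos hyn]
      exact hmono ⟨hx, hxn⟩ ⟨hy, hyn⟩ hxy
    · by_cases hxn : x ≤ n
      · simp only [H, if_pos hxn, if_neg hyn]
        have h1 := hmono.monotoneOn ⟨hx, hxn⟩ hnmem hxn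
        have h2 : 0 < (y - n) * (2 - h n) := mul_pos (by linarith) (by linarith)
        linarith
      · simp only [H, if_neg hxn, if_neg hyn]
        have h2 : 0 < (y - x) * (2 - h n) := mul_pos (by linarith) (by linarith)
        linarith
  refine ⟨γ', ?_, ?_, hγ'le, ?_⟩
  · refine Continuous.if_le hγ (hφ.continuous.comp (by fun_prop)) continuous_id
      continuous_const ?_
    rintro t (rfl : t = n)
    simpa using (hh t hnmem).symm
  · intro t
    rcases lt_or_ge t n with ht | ht
    · obtain ⟨U, hU, hUi⟩ := hγi t
      refine ⟨U ∩ Iio n, inter_mem hU (Iio_mem_nhds ht), ?_⟩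
      exact (hγ'le.mono (inter_subset_right.trans Iio_subset_Iic_self)).injOn_iff.2
        (hUi.mono inter_subset_left)
    · refine ⟨Ici (n - ε), Ici_mem_nhds (by linarith), fun x hx y hy hxy => ?_⟩
      rw [hγ'H x hx, hγ'H y hy] at hxy
      exact hH.injOn hx hy (hφ.injective hxy)
  · rintro _ ⟨r, ⟨hr1, hr2⟩, rfl⟩
    have hpos : 0 < 2 - h n := by linarith
    have hq : 0 < (r - h n) / (2 - h n) := div_pos (by linarith) hpos
    refine ⟨n + (r - h n) / (2 - h n), ⟨by linarith, ?_⟩, ?_⟩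
    · have : (r - h n) / (2 - h n) ≤ 1 := (div_le_one hpos).2 (by linarith)
      linarith
    · have hnot : ¬ n + (r - h n) / (2 - h n) ≤ n := by linarith
      simp only [γ', if_neg hnot, add_sub_cancel_left, div_mul_cancel₀ _ hpos.ne',
        add_sub_cancel]

lemma LocallyInjective.exists_extension {γ : ℝ → Z} (hγ : Continuous γ)
    (hγi : LocallyInjective γ) {n s : ℝ} {φ : ℝ → Z} (hφ : IsOpenEmbedding φ)
    (hs : s ∈ Ioo (-1 : ℝ) 1) (hn : φ s = γ n) :
    ∃ γ' : ℝ → Z, Continuous γ' ∧ LocallyInjective γ' ∧ EqOn γ' γ (Iic n) ∧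
      ∃ φ' ∈ ({φ, φ ∘ Neg.neg} : Set (ℝ → Z)), φ' '' Icc 1 2 ⊆ γ' '' Icc n (n + 1) := by
  obtain ⟨U, hU, hUi⟩ := hγi n
  have hmem : U ∩ γ ⁻¹' range φ ∈ 𝓝 n := inter_mem hU
    (hγ.continuousAt.preimage_mem_nhds (hφ.isOpen_range.mem_nhds ⟨s, hn⟩))
  obtain ⟨δ, hδ, hsub⟩ := Metric.nhds_basis_closedBall.mem_iff.1 hmem
  have hIcc : Icc (n - δ) n ⊆ U ∩ γ ⁻¹' range φ := by
    rw [Real.closedBall_eq_Icc] at hsub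
    exact (Icc_subset_Icc_right (by linarith)).trans hsub
  let h : ℝ → ℝ := fun t => Function.invFun φ (γ t)
  have hh : ∀ t ∈ Icc (n - δ) n, φ (h t) = γ t := fun t ht =>
    Function.invFun_eq (hIcc ht).2
  have hhn : h n = s := hφ.injective ((hh n ⟨by linarith, le_rfl⟩).trans hn.symm)
  have hc : ContinuousOn h (Icc (n - δ) n) :=
    hφ.isEmbedding.continuousOn_iff.2 (hγ.continuousOn.congr hh)
  have hi : InjOn h (Icc (n - δ) n) := by
    intro x hx y hy hxy
    refine hUi (hIcc hx).1 (hIcc hy).1 ?_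
    rw [← hh x hx, ← hh y hy, hxy]
  rcases hc.strictMonoOn_of_injOn_Icc' (by linarith) hi with hm | hm
  · obtain ⟨γ', h1, h2, h3, h4⟩ := hγi.exists_extension_of_strictMonoOn hγ hδ hφ hm hh
      (hhn ▸ hs.2)
    exact ⟨γ', h1, h2, h3, φ, by simp, h4⟩
  · obtain ⟨γ', h1, h2, h3, h4⟩ := hγi.exists_extension_of_strictMonoOn hγ hδ
      (φ := φ ∘ Neg.neg) (h := fun t => -h t)
      (hφ.comp (Homeomorph.neg ℝ).isOpenEmbedding) hm.neg
      (fun t ht => by simpa using hh t ht) (by simp only [hhn]; linarith [hs.1])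
    exact ⟨γ', h1, h2, h3, φ ∘ Neg.neg, by simp, h4⟩

/-- Starting from a non-injective locally injective curve, a shortest loop is simple. -/
lemma LocallyInjective.exists_simple_loop [T2Space Z] {γ : ℝ → Z} (hγ : Continuous γ)
    (hγi : LocallyInjective γ) {s t : ℝ} (hst : s < t) (heq : γ s = γ t) :
    ∃ a b : ℝ, a < b ∧ γ a = γ b ∧ InjOn γ (Ico a b) := by
  -- double points off the diagonal form a compact set, as the diagonal is isolated among them
  let V : Set (ℝ × ℝ) := interior {q | γ q.1 = γ q.2 → q.1 = q.2}
  have hdiag : ∀ x, (x, x) ∈ V := by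
    intro x
    obtain ⟨U, hU, hUi⟩ := hγi x
    exact mem_interior_iff_mem_nhds.2
      (mem_of_superset (prod_mem_nhds hU hU) fun q hq h => hUi hq.1 hq.2 h)
  let D : Set (ℝ × ℝ) := Icc s t ×ˢ Icc s t ∩ ({q | γ q.1 = γ q.2} ∩ {q | q.1 ≤ q.2} ∩ Vᶜ)
  have hD : IsCompact D := (isCompact_Icc.prod isCompact_Icc).inter_right
    (((isClosed_eq (by fun_prop) (by fun_prop)).inter
      (isClosed_le (by fun_prop) (by fun_prop))).inter isOpen_interior.isClosed_compl)
  have hmemD : ∀ x y, x ∈ Icc s t → y ∈ Icc s t → x < y → γ x = γ y → (x, y) ∈ D := by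
    refine fun x y hx hy hxy h => ⟨⟨hx, hy⟩, ⟨h, hxy.le⟩, fun hV => ?_⟩
    exact hxy.ne (interior_subset hV h)
  obtain ⟨⟨a, b⟩, ⟨⟨ha, hb⟩, ⟨hab, hle⟩, hV⟩, hmin⟩ := hD.exists_isMinOn
    (f := fun q : ℝ × ℝ => q.2 - q.1)
    ⟨(s, t), hmemD s t (left_mem_Icc.2 hst.le) (right_mem_Icc.2 hst.le) hst heq⟩ (by fun_prop)
  have hlt : a < b := lt_of_le_of_ne hle fun h : a = b => hV (h ▸ hdiag a)
  refine ⟨a, b, hlt, hab, ?_⟩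
  have key : ∀ x ∈ Ico a b, ∀ y ∈ Ico a b, x < y → γ x ≠ γ y := by
    intro x hx y hy hxy h
    have : b - a ≤ y - x := hmin (hmemD x y ⟨ha.1.trans hx.1, hx.2.le.trans hb.2⟩
      ⟨ha.1.trans hy.1, hy.2.le.trans hb.2⟩ hxy h)
    linarith [hx.1, hy.2]
  intro x hx y hy h
  by_contra hne
  rcases lt_or_gt_of_ne hne with hlt | hlt
  · exact key x hx y hy hlt h
  · exact key y hy x hx hlt h.symm

/-- A compact one-manifold contains a simple closed curve: a locally injective curve that keeps
running to the ends of finitely many charts traverses the same chart end twice. -/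
lemma exists_continuous_injective_addCircle [CompactSpace Z] [T2Space Z] [Nonempty Z]
    (hch : ∀ z : Z, ∃ φ : ℝ → Z, IsOpenEmbedding φ ∧ φ 0 = z) :
    ∃ p : ℝ, 0 < p ∧ ∃ e : AddCircle p → Z, Continuous e ∧ Function.Injective e := by
  choose φ hφ hφ0 using hch
  obtain ⟨c, -, hc⟩ := isCompact_univ.elim_nhds_subcover (fun z => φ z '' Ioo (-1) 1)
    (fun z _ => ((hφ z).isOpenMap _ isOpen_Ioo).mem_nhds ⟨0, by norm_num, hφ0 z⟩)
  -- the finitely many charts whose middle parts cover, in both orientations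
  let S : Set (ℝ → Z) := ⋃ z ∈ c, {φ z, φ z ∘ Neg.neg}
  have hS : S.Finite := c.finite_toSet.biUnion fun z _ => by simp
  have hSi : ∀ ψ ∈ S, Function.Injective ψ := by
    intro ψ hψ
    obtain ⟨z, -, rfl | rfl⟩ := mem_iUnion₂.1 hψ
    · exact (hφ z).injective
    · exact (hφ z).injective.comp neg_injective
  have hpath : ∀ N : ℕ, ∃ γ : ℝ → Z, Continuous γ ∧ LocallyInjective γ ∧
      ∀ k < N, ∃ ψ ∈ S, ψ '' Icc 1 2 ⊆ γ '' Icc (k : ℝ) (k + 1) := by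
    intro N
    induction N with
    | zero =>
      let z : Z := Classical.arbitrary Z
      exact ⟨φ z, (hφ z).continuous, fun t => ⟨univ, univ_mem, (hφ z).injective.injOn⟩,
        fun k hk => absurd hk (Nat.not_lt_zero k)⟩
    | succ N ih =>
      obtain ⟨γ, hγ, hγi, hγS⟩ := ih
      obtain ⟨z, hz, s, hs, hsN⟩ := mem_iUnion₂.1 (hc (mem_univ (γ N)))
      obtain ⟨γ', h1, h2, h3, ψ, hψ, h4⟩ := hγi.exists_extension hγ (hφ z) hs hsN
      refine ⟨γ', h1, h2, fun k hk => ?_⟩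
      rcases (Nat.lt_succ_iff.1 hk).lt_or_eq with hlt | rfl
      · obtain ⟨ψ, hψ, hsub⟩ := hγS k hlt
        refine ⟨ψ, hψ, ?_⟩
        have hkN : (k : ℝ) + 1 ≤ N := by exact_mod_cast hlt
        rwa [(h3.mono (Icc_subset_Iic_self.trans (Iic_subset_Iic.2 hkN))).image_eq]
      · exact ⟨ψ, mem_iUnion₂.2 ⟨z, hz, hψ⟩, h4⟩
  obtain ⟨γ, hγ, hγi, hγS⟩ := hpath (hS.toFinset.card + 1)
  obtain ⟨s, t, hst, heq⟩ : ∃ s t, s < t ∧ γ s = γ t := by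
    choose! ψ hψS hψ using hγS
    obtain ⟨k, hk, l, hl, hne, hkl⟩ := Finset.exists_ne_map_eq_of_card_lt_of_maps_to
      (s := Finset.range (hS.toFinset.card + 1)) (t := hS.toFinset) (f := ψ) (by simp)
      (fun k hk => hS.mem_toFinset.2 (hψS k (Finset.mem_range.1 hk)))
    wlog hlt : k < l generalizing k l
    · exact this l hl k hk hne.symm hkl.symm (lt_of_le_of_ne (not_lt.1 hlt) hne.symm)
    have hkl' : (k : ℝ) + 1 ≤ l := by exact_mod_cast hlt
    have hk' := hψ k (Finset.mem_range.1 hk)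
    have hl' := hψ l (Finset.mem_range.1 hl)
    rw [← hkl] at hl'
    have h1 : (1 : ℝ) ∈ Icc (1 : ℝ) 2 := by norm_num
    have h2 : (2 : ℝ) ∈ Icc (1 : ℝ) 2 := by norm_num
    obtain ⟨x₁, hx₁, hx₁'⟩ := hk' (mem_image_of_mem _ h1)
    obtain ⟨y₁, hy₁, hy₁'⟩ := hl' (mem_image_of_mem _ h1)
    obtain ⟨x₂, hx₂, hx₂'⟩ := hk' (mem_image_of_mem _ h2)
    obtain ⟨y₂, hy₂, hy₂'⟩ := hl' (mem_image_of_mem _ h2)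
    rcases (hx₁.2.trans (hkl'.trans hy₁.1)).lt_or_eq with hlt₁ | heq₁
    · exact ⟨x₁, y₁, hlt₁, hx₁'.trans hy₁'.symm⟩
    rcases (hx₂.2.trans (hkl'.trans hy₂.1)).lt_or_eq with hlt₂ | heq₂
    · exact ⟨x₂, y₂, hlt₂, hx₂'.trans hy₂'.symm⟩
    -- the two time intervals share at most one point, but a chart end has more than one
    have e₁ : x₁ = k + 1 := le_antisymm hx₁.2 (by rw [heq₁]; exact hkl'.trans hy₁.1)
    have e₂ : x₂ = k + 1 := le_antisymm hx₂.2 (by rw [heq₂]; exact hkl'.trans hy₂.1)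
    have : (1 : ℝ) = 2 := hSi _ (hψS k (Finset.mem_range.1 hk)) (by
      rw [← hx₁', ← hx₂', e₁, e₂])
    norm_num at this
  obtain ⟨a, b, hab, hγab, hinj⟩ := hγi.exists_simple_loop hγ hst heq
  have : Fact (0 < b - a) := ⟨sub_pos.2 hab⟩
  refine ⟨b - a, sub_pos.2 hab, AddCircle.liftIco (b - a) a γ,
    AddCircle.liftIco_continuous (by rwa [add_sub_cancel]) hγ.continuousOn, ?_⟩
  refine (injOn_iff_injective.1 ?_).comp (AddCircle.equivIco (b - a) a).injective
  rwa [add_sub_cancel]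

/-- Invariance of domain: a simple closed curve in a one-manifold is open. -/
lemma isOpen_range_of_injective_addCircle {p : ℝ} (hp : 0 < p)
    (hch : ∀ z : Z, ∃ φ : ℝ → Z, IsOpenEmbedding φ ∧ φ 0 = z) {e : AddCircle p → Z}
    (he : Continuous e) (hi : Function.Injective e) : IsOpen (range e) := by
  have : Fact (0 < p) := ⟨hp⟩
  refine isOpen_iff_mem_nhds.2 ?_
  rintro _ ⟨x, rfl⟩
  obtain ⟨t, rfl⟩ := QuotientAddGroup.mk_surjective x
  obtain ⟨φ, hφ, hφ0⟩ := hch (e (t : AddCircle p))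
  have hc : Continuous fun r : ℝ => e (r : AddCircle p) := he.comp (AddCircle.continuous_mk' p)
  have hU : (Ioo (t - p / 2) (t + p / 2) ∩ (fun r : ℝ => e (r : AddCircle p)) ⁻¹' range φ) ∈ 𝓝 t :=
    inter_mem (Ioo_mem_nhds (by linarith) (by linarith))
      (hc.continuousAt.preimage_mem_nhds (hφ.isOpen_range.mem_nhds ⟨0, hφ0⟩))
  obtain ⟨u, hu, hu0, hur⟩ := IsOpenEmbedding.id.exists_shrink hU
  have hu0 : u 0 = t := hu0
  obtain ⟨h, hhc, hh⟩ := hφ.isEmbedding.exists_continuous_lift (hc.comp hu.continuous)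
    (by rintro _ ⟨s, rfl⟩; exact (hur (mem_range_self s)).2)
  have hhi : Function.Injective h := by
    intro x y hxy
    have h1 : e (u x : AddCircle p) = e (u y : AddCircle p) := by
      have := congrArg φ hxy
      rwa [show φ (h x) = _ from congrFun hh x, show φ (h y) = _ from congrFun hh y] at this
    have hmem : ∀ s, u s ∈ Ico (t - p / 2) (t - p / 2 + p) := fun s => by
      have := (hur (mem_range_self s)).1
      exact ⟨this.1.le, by linarith [this.2]⟩
    exact hu.injective ((AddCircle.coe_eq_coe_iff_of_mem_Ico (hmem x) (hmem y)).1 (hi h1))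
  have hopen := (hφ.comp (hhc.isOpenEmbedding_of_injective_real hhi)).isOpen_range
  rw [hh] at hopen
  refine mem_of_superset (hopen.mem_nhds ⟨0, by simp [hu0]⟩) ?_
  rintro _ ⟨s, rfl⟩
  exact ⟨_, rfl⟩

end Curve

/-! ### Minimal systems with a chart are unions of circles -/

/-- The images of a simple closed curve under a minimal homeomorphism of a one-manifold are
pairwise equal or disjoint, as they are connected, open and closed, and they exhaust the space. -/
lemma IsMinimalMap.isFiniteUnionOfCircles {Z : Type*} [TopologicalSpace Z] [CompactSpace Z]
    [T2Space Z] {F : Z → Z} (hF : Continuous F) (hm : IsMinimalMap F) {ψ : ℝ → Z}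
    (hψ : IsOpenEmbedding ψ) : IsFiniteUnionOfCircles Z := by
  have hch := hm.exists_chart hF hψ
  have hFi := hm.injective_of_chart hF hψ
  have : Nonempty Z := ⟨ψ 0⟩
  obtain ⟨p, hp, e, he, hei⟩ := exists_continuous_injective_addCircle hch
  have : Fact (0 < p) := ⟨hp⟩
  have hcl : ∀ k, IsClopen (F^[k] '' range e) := fun k => by
    rw [← range_comp]
    have hc := (hF.iterate k).comp he
    exact ⟨(isCompact_range hc).isClosed,
      isOpen_range_of_injective_addCircle hp hch hc ((hFi.iterate k).comp hei)⟩
  have hconn : ∀ k, IsPreconnected (F^[k] '' range e) := fun k =>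
    (isPreconnected_range he).image _ (hF.iterate k).continuousOn
  have heq : ∀ j k, (F^[j] '' range e ∩ F^[k] '' range e).Nonempty →
      F^[j] '' range e = F^[k] '' range e := fun j k h =>
    ((hconn j).subset_isClopen (hcl k) h).antisymm
      ((hconn k).subset_isClopen (hcl j) (by rwa [inter_comm]))
  have hex : ∃ n, 0 < n ∧ F^[n] '' range e = range e := by
    obtain ⟨n, x, hx⟩ := hm.exists_iterate_mem (by simpa using (hcl 0).isOpen : IsOpen (range e))
      (range_nonempty e) (F (e 0))
    refine ⟨n + 1, n.succ_pos, ?_⟩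
    have := heq (n + 1) 0 ⟨e x, ⟨e 0, mem_range_self _, hx.symm⟩, e x, mem_range_self _, rfl⟩
    simpa using this
  classical
  let n := Nat.find hex
  obtain ⟨hn0, hn⟩ : 0 < n ∧ F^[n] '' range e = range e := Nat.find_spec hex
  let Φ : (Σ _ : Fin n, AddCircle p) → Z := fun q => F^[q.1] (e q.2)
  have hΦc : Continuous Φ := continuous_sigma fun k => (hF.iterate k).comp he
  have hlt : ∀ (j k : Fin n) x y, F^[j] (e x) = F^[k] (e y) → ¬ j < k := by
    intro j k x y hxy hjk
    have hjk : (j : ℕ) < k := hjk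
    refine Nat.find_min hex (show (k : ℕ) - j < n by omega) ⟨by omega, ?_⟩
    have h := heq k j ⟨F^[k] (e y), ⟨e y, mem_range_self _, rfl⟩, e x, mem_range_self _, hxy⟩
    refine (image_injective.2 (hFi.iterate j)) ?_
    rw [← h, ← image_comp, ← Function.iterate_add, Nat.add_sub_cancel' hjk.le]
  have hΦi : Function.Injective Φ := by
    rintro ⟨j, x⟩ ⟨k, y⟩ hxy
    have hxy : F^[j] (e x) = F^[k] (e y) := hxy
    obtain rfl : j = k :=
      le_antisymm (not_lt.1 (hlt k j y x hxy.symm)) (not_lt.1 (hlt j k x y hxy))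
    rw [hei (hFi.iterate j hxy)]
  have hΦs : Function.Surjective Φ := by
    refine range_eq_univ.1 (hm.eq_univ (isCompact_range hΦc).isClosed
      ⟨_, mem_range_self ⟨⟨0, hn0⟩, 0⟩⟩ ?_)
    rintro _ ⟨⟨k, x⟩, rfl⟩
    rcases (Nat.succ_le_of_lt k.2).lt_or_eq with hk | hk
    · exact ⟨⟨⟨k + 1, hk⟩, x⟩, Function.iterate_succ_apply' F k (e x)⟩
    · have : F^[n] (e x) ∈ range e := hn ▸ mem_image_of_mem _ (mem_range_self x)
      obtain ⟨y, hy⟩ := this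
      refine ⟨⟨⟨0, hn0⟩, y⟩, ?_⟩
      change e y = F (F^[k] (e x))
      rw [hy, ← Function.iterate_succ_apply' F k, hk]
  let E := hΦc.homeoOfEquivCompactToT2 (f := Equiv.ofBijective Φ ⟨hΦi, hΦs⟩)
  let C : (Σ _ : Fin n, AddCircle p) ≃ₜ (Σ _ : Fin n, Circle) :=
    { toEquiv := Equiv.sigmaCongrRight fun _ => (AddCircle.homeomorphCircle hp.ne').toEquiv
      continuous_toFun := continuous_sigma fun k =>
        continuous_sigmaMk.comp (AddCircle.homeomorphCircle hp.ne').continuous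
      continuous_invFun := continuous_sigma fun k =>
        continuous_sigmaMk.comp (AddCircle.homeomorphCircle hp.ne').symm.continuous }
  exact ⟨n, hn0, ⟨E.symm.trans C⟩⟩

/-! ### Minimal sets that are nowhere dense in a free interval -/

/-- If `M` contains no interval of the chart `ψ`, then a connected subset of `M` meeting the chart
is confined between points of the chart outside `M`, arbitrarily close to each other. -/
lemma IsPreconnected.eq_singleton_of_chart {X : Type*} [TopologicalSpace X] [T2Space X]
    {ψ : ℝ → X} (hψ : IsOpenEmbedding ψ) {M C : Set X} (hM : interior (ψ ⁻¹' M) = ∅)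
    (hC : IsPreconnected C) (hCM : C ⊆ M) {t : ℝ} (ht : ψ t ∈ C) : C = {ψ t} := by
  have hgap : ∀ x y : ℝ, x < y → ∃ a ∈ Ioo x y, ψ a ∉ M := fun x y hxy => by
    by_contra! h
    have : Ioo x y ⊆ interior (ψ ⁻¹' M) := interior_maximal h isOpen_Ioo
    rw [hM, subset_empty_iff, Ioo_eq_empty_iff] at this
    exact this hxy
  have hconf : ∀ x y : ℝ, x < t → t < y → C ⊆ ψ '' Ioo x y := by
    intro x y hx hy
    obtain ⟨a, ha, haM⟩ := hgap x t hx
    obtain ⟨b, hb, hbM⟩ := hgap t y hy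
    have hsub : C ⊆ ψ '' Ioo a b ∪ (ψ '' Icc a b)ᶜ := by
      intro c hc
      by_cases h : c ∈ ψ '' Icc a b
      · obtain ⟨s, hs, rfl⟩ := h
        have hsa : a ≠ s := fun h => haM (h ▸ hCM hc)
        have hsb : s ≠ b := fun h => hbM (h ▸ hCM hc)
        exact Or.inl ⟨s, ⟨lt_of_le_of_ne hs.1 hsa, lt_of_le_of_ne hs.2 hsb⟩, rfl⟩
      · exact Or.inr h
    have hdisj : Disjoint (ψ '' Ioo a b) (ψ '' Icc a b)ᶜ :=
      disjoint_compl_right_iff_subset.2 (image_mono Ioo_subset_Icc_self)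
    have := hC.subset_left_of_subset_union (hψ.isOpenMap _ isOpen_Ioo)
      (isCompact_Icc.image hψ.continuous).isClosed.isOpen_compl hdisj hsub
      ⟨ψ t, ht, t, ⟨ha.2, hb.1⟩, rfl⟩
    exact this.trans (image_mono (Ioo_subset_Ioo ha.1.le hb.2.le))
  refine eq_singleton_iff_unique_mem.2 ⟨ht, fun c hc => ?_⟩
  obtain ⟨s, -, rfl⟩ := hconf (t - 1) (t + 1) (by linarith) (by linarith) hc
  refine congrArg ψ (not_ne_iff.1 fun hne => ?_)
  rcases lt_or_gt_of_ne hne with hlt | hlt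
  · obtain ⟨r, hr, hrs⟩ := hconf s (t + 1) hlt (by linarith) hc
    exact hr.1.ne (hψ.injective hrs).symm
  · obtain ⟨r, hr, hrs⟩ := hconf (t - 1) s (by linarith) hlt hc
    exact hr.2.ne (hψ.injective hrs)

/-- An infinite minimal system is a cantoroid as soon as the components of the points of some
nonempty open set `U` are trivial. The component of a point `y` with `F^n y ∈ U` lies in a fibre of
`F^n`, and the points alone in their fibre are dense. -/
lemma IsMinimalMap.isCantoroid {Z : Type*} [TopologicalSpace Z] [CompactSpace Z]
    [TopologicalSpace.MetrizableSpace Z] [Infinite Z] {F : Z → Z} (hF : Continuous F)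
    (hm : IsMinimalMap F) {U : Set Z} (hU : IsOpen U) (hne : U.Nonempty)
    (hconn : ∀ C : Set Z, IsPreconnected C → (C ∩ U).Nonempty → C.Subsingleton) :
    IsCantoroid Z := by
  refine ⟨inferInstance, inferInstance, fun y hy => ?_, ?_⟩
  · have := hm.finite_of_isOpen_singleton hF hy
    exact not_finite Z
  · refine dense_iff_inter_open.2 fun V hV ⟨v, hv⟩ => ?_
    obtain ⟨n, hn⟩ := hm.exists_iterate_mem hU hne v
    obtain ⟨y, ⟨hyV, hyU⟩, hy⟩ := ((hm.isIrreducibleMap hF).iterate n).exists_fiber_singleton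
      (hF.iterate n) (hV.inter (hU.preimage (hF.iterate n))) ⟨v, hv, hn⟩
    refine ⟨y, hyV, eq_singleton_iff_unique_mem.2 ⟨mem_connectedComponent, fun z hz => hy z ?_⟩⟩
    have hC := (isPreconnected_connectedComponent (x := y)).image F^[n]
      (hF.iterate n).continuousOn
    exact hconn _ hC ⟨F^[n] y, mem_image_of_mem _ mem_connectedComponent, hyU⟩
      (mem_image_of_mem _ hz) (mem_image_of_mem _ mem_connectedComponent)

/-- If an infinite minimal set `M` meets a chart but contains no interval of it, then it has empty
interior: otherwise some iterate would carry a small interval around a point of `M` into `M` and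
back to the chart, hence to a single point. -/
lemma IsMinimalMap.isNowhereDense {X : Type*} [TopologicalSpace X] [CompactSpace X] [T2Space X]
    {f : X → X} (hf : Continuous f) {M : Set X} (hM : IsClosed M) (hMinf : M.Infinite)
    {hmaps : MapsTo f M M} (hm : IsMinimalMap (hmaps.restrict f M M)) {ψ : ℝ → X}
    (hψ : IsOpenEmbedding ψ) (hint : interior (ψ ⁻¹' M) = ∅) {t : ℝ} (ht : ψ t ∈ M) :
    IsNowhereDense M := by
  rw [hM.isNowhereDense_iff, ← not_nonempty_iff_eq_empty]
  rintro ⟨o, ho⟩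
  have : CompactSpace M := isCompact_iff_compactSpace.1 hM.isCompact
  have : Infinite M := hMinf.to_subtype
  have hF : Continuous (hmaps.restrict f M M) := hf.restrict hmaps
  have hit : ∀ n (x : M), ((hmaps.restrict f M M)^[n] x : X) = f^[n] x := fun n x => by
    rw [hmaps.iterate_restrict]; rfl
  obtain ⟨n, hn⟩ := hm.exists_iterate_mem (U := Subtype.val ⁻¹' interior M)
    (isOpen_interior.preimage continuous_subtype_val) ⟨⟨o, interior_subset ho⟩, ho⟩ ⟨ψ t, ht⟩
  have hn : f^[n] (ψ t) ∈ interior M := by simpa [hit] using hn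
  obtain ⟨ψ', hψ', h0, hr⟩ := hψ.exists_shrink
    ((hf.iterate n).continuousAt.preimage_mem_nhds (isOpen_interior.mem_nhds hn))
  obtain ⟨m, hm'⟩ := hm.exists_iterate_mem (U := Subtype.val ⁻¹' range ψ)
    (hψ.isOpen_range.preimage continuous_subtype_val) ⟨⟨ψ t, ht⟩, t, rfl⟩
    ⟨f^[n] (ψ t), interior_subset hn⟩
  obtain ⟨s, hs⟩ : f^[m] (f^[n] (ψ t)) ∈ range ψ := by simpa [hit] using hm'
  have hC : IsPreconnected (f^[m] '' (f^[n] '' range ψ')) :=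
    ((isPreconnected_range hψ'.continuous).image _ (hf.iterate n).continuousOn).image _
      (hf.iterate m).continuousOn
  have hCM : f^[m] '' (f^[n] '' range ψ') ⊆ M := by
    rintro _ ⟨_, ⟨x, hx, rfl⟩, rfl⟩
    exact hmaps.iterate m (interior_subset (hr hx))
  have hCs := hC.eq_singleton_of_chart hψ hint hCM (t := s)
    ⟨_, mem_image_of_mem _ ⟨0, h0⟩, hs.symm⟩
  refine hm.not_const_on_open hF (V := Subtype.val ⁻¹' range ψ')
    (hψ'.isOpen_range.preimage continuous_subtype_val) ⟨⟨ψ t, ht⟩, 0, h0⟩ (m + n)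
    ⟨ψ s, hCM (hCs ▸ mem_singleton _)⟩ fun v hv => Subtype.ext ?_
  rw [hit, Function.iterate_add_apply]
  have : f^[m] (f^[n] v) ∈ f^[m] '' (f^[n] '' range ψ') :=
    mem_image_of_mem _ (mem_image_of_mem _ hv)
  rwa [hCs] at this

/-! ### The trichotomy -/

lemma IsCantoroid.infinite {Y : Type*} [TopologicalSpace Y] [Nonempty Y] (h : IsCantoroid Y) :
    Infinite Y := by
  obtain ⟨-, _, hiso, -⟩ := h
  by_contra hfin
  have := not_infinite_iff_finite.1 hfin
  exact hiso (Classical.arbitrary Y) (isOpen_discrete _)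

lemma IsFiniteUnionOfCircles.exists_embedding {Y : Type*} [TopologicalSpace Y]
    (h : IsFiniteUnionOfCircles Y) (y : Y) :
    ∃ e : Circle → Y, Continuous e ∧ Function.Injective e ∧ y ∈ range e := by
  obtain ⟨n, -, ⟨E⟩⟩ := h
  let i : Circle → Σ _ : Fin n, Circle := Sigma.mk (β := fun _ => Circle) (E y).1
  have hi : Function.Injective i := sigma_mk_injective
  refine ⟨E.symm ∘ i, E.symm.continuous.comp continuous_sigmaMk, E.symm.injective.comp hi,
    (E y).2, ?_⟩
  exact E.symm_apply_apply y

lemma Circle.infinite : Infinite Circle :=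
  Circle.argEquiv.infinite_iff.2
    (Ioc_infinite (neg_lt_self Real.pi_pos)).to_subtype

theorem theoremB {X : Type*} [TopologicalSpace X] [CompactSpace X]
    [TopologicalSpace.MetrizableSpace X] (J : Set X) (hJ : IsFreeInterval J)
    (f : X → X) (hf : Continuous f) (M : Set X) (hM : IsMinimalSet f M)
    (hMJ : (M ∩ J).Nonempty) :
    (M.Finite ∨ (IsNowhereDense M ∧ IsCantoroid M) ∨ IsFiniteUnionOfCircles M) ∧
      ¬ (M.Finite ∧ (IsNowhereDense M ∧ IsCantoroid M)) ∧
      ¬ (M.Finite ∧ IsFiniteUnionOfCircles M) ∧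
      ¬ ((IsNowhereDense M ∧ IsCantoroid M) ∧ IsFiniteUnionOfCircles M) := by
  obtain ⟨hMne, hMcl, hmaps, hm⟩ := hM
  have : Nonempty M := hMne.to_subtype
  have : CompactSpace M := isCompact_iff_compactSpace.1 hMcl.isCompact
  have hF : Continuous (hmaps.restrict f M M) := hf.restrict hmaps
  refine ⟨?_, ?_, ?_, ?_⟩
  · refine or_iff_not_imp_left.2 fun hMinf => ?_
    have hMinf : M.Infinite := hMinf
    have : Infinite M := hMinf.to_subtype
    obtain ⟨ψ, hψ, rfl⟩ := hJ.exists_chart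
    obtain ⟨_, htM, t, rfl⟩ := hMJ
    rcases (interior (ψ ⁻¹' M)).eq_empty_or_nonempty with hint | ⟨s, hs⟩
    · refine Or.inl ⟨hm.isNowhereDense hf hMcl hMinf hψ hint htM, ?_⟩
      refine hm.isCantoroid hF (U := Subtype.val ⁻¹' range ψ)
        (hψ.isOpen_range.preimage continuous_subtype_val) ⟨⟨ψ t, htM⟩, t, rfl⟩ ?_
      rintro C hC ⟨c, hcC, r, hr⟩
      have := (hC.image _ continuous_subtype_val.continuousOn).eq_singleton_of_chart hψ hint
        (by rintro _ ⟨x, -, rfl⟩; exact x.2) (t := r) ⟨c, hcC, hr.symm⟩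
      refine subsingleton_of_image Subtype.val_injective _ ?_
      exact this ▸ subsingleton_singleton
    · obtain ⟨ψ', hψ', -, hr⟩ := hψ.exists_shrink (t := s) (U := M) (by
        have := hψ.isOpenMap.image_mem_nhds (mem_interior_iff_mem_nhds.1 hs)
        exact mem_of_superset this (image_preimage_subset _ _))
      -- an interval of the chart contained in `M` is a chart of `M`
      let χ : ℝ → M := fun r => ⟨ψ' r, hr (mem_range_self r)⟩
      have hχ : IsOpenEmbedding χ := by
        refine .of_continuous_injective_isOpenMap (hψ'.continuous.subtype_mk _)
          (fun x y h => hψ'.injective (congrArg Subtype.val h)) fun O hO => ?_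
        have : χ '' O = Subtype.val ⁻¹' (ψ' '' O) := by
          ext y
          simp [χ, Subtype.ext_iff]
        rw [this]
        exact (hψ'.isOpenMap O hO).preimage continuous_subtype_val
      exact Or.inr (hm.isFiniteUnionOfCircles hF hχ)
  · rintro ⟨hfin, -, hcant⟩
    exact (infinite_coe_iff.1 hcant.infinite) hfin
  · rintro ⟨hfin, hcirc⟩
    obtain ⟨e, -, hi, -⟩ := hcirc.exists_embedding (Classical.arbitrary M)
    have : Finite M := hfin
    exact Circle.infinite.not_finite (Finite.of_injective e hi)
  · rintro ⟨⟨-, -, -, -, hdense⟩, hcirc⟩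
    obtain ⟨y, hy⟩ := hdense.nonempty
    obtain ⟨e, he, hi, x, rfl⟩ := hcirc.exists_embedding y
    have hsub : range e ⊆ connectedComponent (e x) :=
      (isPreconnected_range he).subset_connectedComponent (mem_range_self x)
    have hall : ∀ x', x' = x := fun x' => hi (by
      have : e x' ∈ connectedComponent (e x) := hsub (mem_range_self x')
      rwa [show connectedComponent (e x) = {e x} from hy] at this)
    have : Subsingleton Circle := ⟨fun a b => (hall a).trans (hall b).symm⟩
    exact Circle.infinite.not_finite inferInstance
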